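/- Let $\mathbb F\in\{\mathbb R,\mathbb C\}$, let $d\ge 1$ and $n\ge 1$ be integers, and let $P(\lambda)=\sum_{i=0}^d\lambda^iA_i$ with $A_i\in\mathbb F^{n,n}$ Hermitian positive semidefinite for $i=0,\dots,d$ (neither $A_d\ne 0$ nor regularity of $P$ is assumed). If $d$ is even, assume in addition that $A_0$ is invertible. Then the index of $P(\lambda)$ is at most $d$. Moreover, the bound is sharp: for every $d\ge1$ and every $n\ge 1$ there is such a $P(\lambda)$ whose index is exactly $d$. Here the index of a pencil $\lambda E-A$ is the size of its largest Jordan block at $\infty$, that is, the size $\sigma$ of the largest block of the form $\lambda\mathcal J_\sigma(0)-I_\sigma$ (where $\mathcal J_\sigma(0)$ is the nilpotent upper triangular $\sigma\times\sigma$ Jordan block) in its complex Kronecker canonical form, and $0$ if there is no such block. The index of $P(\lambda)$ is the index of any strong linearization of it, that is, of any $dn\times dn$ pencil $L(\lambda)=\lambda E-A$ over $\mathbb F$ such that $L(\lambda)$ is equivalent, under multiplication from the left and the right by unimodular polynomial matrices, to $\mathrm{diag}(P(\lambda),I_{(d-1)n})$, and $\lambda A-E$ is equivalent in the same sense to $\mathrm{diag}(\lambda^dP(1/\lambda),I_{(d-1)n})$;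 the index is the same for all such pencils. -/

import Mathlib

open scoped ComplexOrder Polynomial

noncomputable section

/-- The matrix pencil `λ E - A`, given by its two coefficient matrices. -/
structure Pencil (m n : Type) (K : Type*) where
  E : Matrix m n K
  A : Matrix m n K

namespace Pencil

/-- The matrix `λ E - A` over the polynomial ring `K[λ]`. -/
def toPolyMatrix {m n : Type} {K : Type*} [CommRing K] (L : Pencil m n K) : Matrix m n K[X] :=
  (Polynomial.X : K[X]) • L.E.map Polynomial.C - L.A.map Polynomial.C

/-- The reversal `λ A - E` of the pencil `λ E - A`. -/
def rev {m n : Type} {K : Type*} (L : Pencil m n K) : Pencil m n K := ⟨L.A, L.E⟩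

/-- A real or complex pencil, regarded as a complex pencil. (`RCLike.map 𝕜 ℂ` is the inclusion
of `ℝ` for `𝕜 = ℝ`, and the identity for `𝕜 = ℂ`.) -/
def complexify {m n : Type} {𝕜 : Type*} [RCLike 𝕜] (L : Pencil m n 𝕜) : Pencil m n ℂ :=
  ⟨L.E.map (RCLike.map 𝕜 ℂ), L.A.map (RCLike.map 𝕜 ℂ)⟩

end Pencil

/-- The upper triangular Jordan block of size `k` with eigenvalue `μ`. -/
def jordanBlock (k : ℕ) (μ : ℂ) : Matrix (Fin k) (Fin k) ℂ :=
  Matrix.of fun i j => if i = j then μ else if (j : ℕ) = i + 1 then 1 else 0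

/-- The four types of blocks in the Kronecker canonical form. -/
inductive KroneckerBlock : Type
  /-- the right Kronecker block, of size `ε × (ε + 1)` -/
  | L (ε : ℕ)
  /-- the transposed Kronecker block, of size `(η + 1) × η` -/
  | LT (η : ℕ)
  /-- the Jordan block of size `ρ` for the finite eigenvalue `μ` -/
  | J (ρ : ℕ) (μ : ℂ)
  /-- the Jordan block of size `σ` for the eigenvalue `∞` -/
  | N (σ : ℕ)

namespace KroneckerBlock

@[reducible] def rows : KroneckerBlock → ℕ
  | L ε => ε
  | LT η => η + 1
  | J ρ _ => ρ
  | N σ => σ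

@[reducible] def cols : KroneckerBlock → ℕ
  | L ε => ε + 1
  | LT η => η
  | J ρ _ => ρ
  | N σ => σ

/-- The pencil `λ [I 0] - [0 I]` of size `k × (k + 1)`. -/
def rightKronecker (k : ℕ) : Pencil (Fin k) (Fin (k + 1)) ℂ where
  E := Matrix.of fun i j => if (j : ℕ) = i then 1 else 0
  A := Matrix.of fun i j => if (j : ℕ) = i + 1 then 1 else 0

/-- The pencil of a block: a Kronecker block or its transpose, `λ I - J_ρ(μ)`, or
`λ J_σ(0) - I`. -/
def pencil : (b : KroneckerBlock) → Pencil (Fin b.rows) (Fin b.cols) ℂ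
  | L ε => rightKronecker ε
  | LT η => ⟨(rightKronecker η).E.transpose, (rightKronecker η).A.transpose⟩
  | J ρ μ => ⟨(1 : Matrix (Fin ρ) (Fin ρ) ℂ), jordanBlock ρ μ⟩
  | N σ => ⟨jordanBlock σ 0, (1 : Matrix (Fin σ) (Fin σ) ℂ)⟩

end KroneckerBlock

namespace Pencil

/-- The complex pencil `L` is strictly equivalent to the block diagonal pencil with diagonal
blocks `b 0, …, b (r - 1)`; that is, the latter is a Kronecker canonical form of `L`. The
bijections only number the rows and the columns of the block diagonal matrix. (Empty `J` and `N`
blocks are not excluded; they change nothing.) -/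
def IsKroneckerForm {m n : ℕ} (L : Pencil (Fin m) (Fin n) ℂ) {r : ℕ}
    (b : Fin r → KroneckerBlock) : Prop :=
  ∃ (er : (Σ i, Fin (b i).rows) ≃ Fin m) (ec : (Σ i, Fin (b i).cols) ≃ Fin n)
    (S : Matrix (Fin m) (Fin m) ℂ) (T : Matrix (Fin n) (Fin n) ℂ),
    IsUnit S ∧ IsUnit T ∧
    S * L.E * T =
      Matrix.reindex er ec (Matrix.blockDiagonal' fun i => (b i).pencil.E) ∧
    S * L.A * T =
      Matrix.reindex er ec (Matrix.blockDiagonal' fun i => (b i).pencil.A)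

/-- The index of a real or complex pencil: the size of the largest Jordan block for the eigenvalue
`∞` in its (complex) Kronecker canonical form, and `0` if there is none. -/
def index {𝕜 : Type*} [RCLike 𝕜] {m n : ℕ} (L : Pencil (Fin m) (Fin n) 𝕜) : ℕ∞ :=
  ⨆ (σ : ℕ) (_ : ∃ (r : ℕ) (b : Fin r → KroneckerBlock),
    L.complexify.IsKroneckerForm b ∧ ∃ i, b i = KroneckerBlock.N σ), (σ : ℕ∞)

end Pencil

/-- The matrix polynomial `P(λ) = ∑_{i ≤ d} λ^i A_i`. -/
def matPoly {K : Type*} [CommRing K] {d n : ℕ} (A : Fin (d + 1) → Matrix (Fin n) (Fin n) K) :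
    Matrix (Fin n) (Fin n) K[X] :=
  ∑ i : Fin (d + 1), ((Polynomial.X : K[X]) ^ (i : ℕ)) • (A i).map Polynomial.C

/-- The `d n × d n` pencil `L` is a linearization of the `n × n` matrix polynomial `P`: it is
unimodularly equivalent to `diag(P, I_{(d-1)n})`. (`IsUnit U` says that `U` has an inverse with
polynomial entries.) -/
def IsLinearization {K : Type*} [CommRing K] {d n : ℕ} (P : Matrix (Fin n) (Fin n) K[X])
    (L : Pencil (Fin (d * n)) (Fin (d * n)) K) : Prop :=
  ∃ (e : Fin n ⊕ Fin ((d - 1) * n) ≃ Fin (d * n))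
    (U V : Matrix (Fin (d * n)) (Fin (d * n)) K[X]), IsUnit U ∧ IsUnit V ∧
    U * L.toPolyMatrix * V =
      Matrix.reindex e e
        (Matrix.fromBlocks P 0 0 (1 : Matrix (Fin ((d - 1) * n)) (Fin ((d - 1) * n)) K[X]))

/-- `L` is a strong linearization of `P(λ) = ∑_{i ≤ d} λ^i A_i`: it is a linearization of `P`, and
its reversal is one of the reversal `λ^d P(1/λ) = ∑_{i ≤ d} λ^i A_{d-i}`. -/
def IsStrongLinearization {K : Type*} [CommRing K] {d n : ℕ}
    (A : Fin (d + 1) → Matrix (Fin n) (Fin n) K)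
    (L : Pencil (Fin (d * n)) (Fin (d * n)) K) : Prop :=
  IsLinearization (matPoly A) L ∧ IsLinearization (matPoly fun i => A i.rev) L.rev

/-- The index of the matrix polynomial `P(λ) = ∑_{i ≤ d} λ^i A_i`, regarded as a polynomial of
grade `d`: the index of a strong linearization of `P`. All strong linearizations of `P` have the
same index, so that the supremum below is this common value. -/
def matPolyIndex {𝕜 : Type*} [RCLike 𝕜] {d n : ℕ}
    (A : Fin (d + 1) → Matrix (Fin n) (Fin n) 𝕜) : ℕ∞ :=
  ⨆ (L : Pencil (Fin (d * n)) (Fin (d * n)) 𝕜) (_ : IsStrongLinearization A L), L.index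

end

open Matrix Polynomial Filter Topology

/-! Reversal moves the eigenvalue ∞ to 0, so the question is how large a block λI - J_σ(0) can be in
the reversed pencil, which is unimodularly equivalent to diag(R, I) with R the reversal of P, again
with positive semidefinite coefficients B_i.

If R u = O(λ^(d+1)), pairing with u(t) for real t > 0 gives a sum of nonnegative terms t^i u(t)* B_i
u(t) of order t^(d+1). Each term is bounded by the sum, so u(0)* B_i u(0) = 0, hence B_i u(0) = 0
for every i (`mulVec_eval_zero_eq_zero`). Thus u agrees modulo λ with the constant kernel vector
u(0). This property, `LiftsKernel (d + 1)`, survives unimodular equivalence, adjoining an identity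
block and passing to a diagonal block. The vector (1, λ, ..., λ^(σ-1)) refutes it for λI - J_σ(0)
when σ ≥ d + 1.

Sharpness comes from P = I in grade d: its reversal is λ^d I, and n Jordan blocks of size d at ∞
form a strong linearization. -/

/-! ### Extension of scalars to ℂ -/

/-- The inclusion of `𝕜` into `ℂ` as a ring homomorphism. -/
noncomputable def RCLike.toComplexHom (𝕜 : Type*) [RCLike 𝕜] : 𝕜 →+* ℂ where
  toFun := RCLike.map 𝕜 ℂ
  map_one' := by simp
  map_zero' := by simp
  map_add' := map_add _
  map_mul' x y := by
    apply Complex.ext <;> simp [RCLike.mul_re, RCLike.mul_im]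

lemma RCLike.star_toComplexHom {𝕜 : Type*} [RCLike 𝕜] (x : 𝕜) :
    star (RCLike.toComplexHom 𝕜 x) = RCLike.toComplexHom 𝕜 (star x) := by
  apply Complex.ext <;> simp [RCLike.toComplexHom]

-- A factorization B*B is preserved by a ring homomorphism commuting with conjugation, so no complex
-- vectors have to be tested against a real form.
open scoped MatrixOrder in
lemma Matrix.PosSemidef.map_toComplexHom {𝕜 : Type*} [RCLike 𝕜] {n : Type*} [Fintype n]
    [DecidableEq n] {A : Matrix n n 𝕜} (hA : A.PosSemidef) :
    (A.map (RCLike.toComplexHom 𝕜)).PosSemidef := by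
  obtain ⟨B, rfl⟩ := CStarAlgebra.nonneg_iff_eq_star_mul_self.mp hA.nonneg
  rw [Matrix.map_mul, Matrix.star_eq_conjTranspose]
  have : (Bᴴ).map (RCLike.toComplexHom 𝕜) = (B.map (RCLike.toComplexHom 𝕜))ᴴ := by
    ext i j
    simp [RCLike.star_toComplexHom, -RCLike.star_def]
  rw [this]
  exact Matrix.posSemidef_conjTranspose_mul_self _

/-! ### Evaluation of matrix polynomials -/

lemma eval_matPoly_mulVec {K : Type*} [CommRing K] {d n : ℕ}
    (B : Fin (d + 1) → Matrix (Fin n) (Fin n) K) (u : Fin n → K[X]) (t : K) :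
    (fun j => ((matPoly B *ᵥ u) j).eval t) =
      ∑ i : Fin (d + 1), t ^ (i : ℕ) • (B i *ᵥ fun j => (u j).eval t) := by
  ext j
  simp only [matPoly, Matrix.sum_mulVec, Finset.sum_apply, Matrix.smul_mulVec, Pi.smul_apply,
    smul_eq_mul, Polynomial.eval_finsetSum, Polynomial.eval_mul, Polynomial.eval_pow,
    Polynomial.eval_X]
  simp [mulVec, dotProduct, Polynomial.eval_finsetSum]

lemma matPoly_map {K F : Type*} [CommRing K] [CommRing F] (f : K →+* F) {d n : ℕ}
    (B : Fin (d + 1) → Matrix (Fin n) (Fin n) K) :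
    (matPoly B).map (Polynomial.mapRingHom f) = matPoly fun i => (B i).map f := by
  ext1 i j
  simp [matPoly, Matrix.sum_apply, Polynomial.map_sum]

lemma Pencil.toPolyMatrix_map {K F : Type*} [CommRing K] [CommRing F] (f : K →+* F) {m n : Type}
    (L : Pencil m n K) :
    L.toPolyMatrix.map (Polynomial.mapRingHom f) =
      (Pencil.mk (L.E.map f) (L.A.map f)).toPolyMatrix := by
  ext1 i j
  simp [Pencil.toPolyMatrix]

/-- If the coefficients are positive semidefinite and `P(λ) u(λ) = O(λ^(d+1))`, then `u(0)` lies
in the kernel of all coefficients. -/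
lemma mulVec_eval_zero_eq_zero {d n : ℕ} {B : Fin (d + 1) → Matrix (Fin n) (Fin n) ℂ}
    (hB : ∀ i, (B i).PosSemidef) {u w : Fin n → ℂ[X]}
    (h : matPoly B *ᵥ u = (X : ℂ[X]) ^ (d + 1) • w) (i : Fin (d + 1)) :
    B i *ᵥ (fun j => (u j).eval 0) = 0 := by
  set v : ℝ → Fin n → ℂ := fun t j => (u j).eval (t : ℂ) with hv
  have hvc : Continuous v := by
    refine continuous_pi fun j => ?_
    exact (u j).continuous.comp Complex.continuous_ofReal
  set g : Fin (d + 1) → ℝ → ℝ := fun i t => (star (v t) ⬝ᵥ (B i *ᵥ v t)).re with hg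
  have hgc : ∀ i, Continuous (g i) := fun i => by
    refine Complex.continuous_re.comp ?_
    exact (continuous_star.comp hvc).dotProduct (continuous_const.matrix_mulVec hvc)
  have hg0 : ∀ i t, 0 ≤ g i t := fun i t =>
    (Complex.le_def.mp ((hB i).dotProduct_mulVec_nonneg (v t))).1
  set k : ℝ → ℝ := fun t => (star (v t) ⬝ᵥ (fun j => (w j).eval (t : ℂ))).re with hk
  have hkc : Continuous k := by
    refine Complex.continuous_re.comp ?_
    refine (continuous_star.comp hvc).dotProduct (continuous_pi fun j => ?_)
    exact (w j).continuous.comp Complex.continuous_ofReal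
  -- Pair the identity at real t with u(t) and take real parts; t being real, its powers stay
  -- outside as real scalars.
  have hsum : ∀ t : ℝ, ∑ i : Fin (d + 1), t ^ (i : ℕ) * g i t = t ^ (d + 1) * k t := by
    intro t
    have h1 := eval_matPoly_mulVec B u (t : ℂ)
    rw [h] at h1
    have h2 := congrArg (fun x => (star (v t) ⬝ᵥ x).re) h1
    have e1 : (fun j => (((X : ℂ[X]) ^ (d + 1) • w) j).eval (t : ℂ)) =
        ((t ^ (d + 1) : ℝ) : ℂ) • fun j => (w j).eval (t : ℂ) := by
      ext j; simp
    simp only [e1, dotProduct_sum, dotProduct_smul, Complex.re_sum, smul_eq_mul,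
      ← Complex.ofReal_pow, Complex.re_ofReal_mul] at h2
    exact h2.symm
  have hle : ∀ t : ℝ, 0 < t → g i t ≤ t ^ (d + 1 - (i : ℕ)) * k t := by
    intro t ht
    have h1 : t ^ (i : ℕ) * g i t ≤ t ^ (d + 1) * k t := by
      rw [← hsum t]
      exact Finset.single_le_sum (f := fun i : Fin (d + 1) => t ^ (i : ℕ) * g i t)
        (fun j _ => mul_nonneg (pow_nonneg ht.le _) (hg0 j t)) (Finset.mem_univ i)
    have h2 : t ^ (d + 1) = t ^ (i : ℕ) * t ^ (d + 1 - (i : ℕ)) := by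
      rw [← pow_add]; congr 1; omega
    rw [h2, mul_assoc] at h1
    exact le_of_mul_le_mul_left h1 (pow_pos ht _)
  have hlim : g i 0 ≤ 0 ^ (d + 1 - (i : ℕ)) * k 0 := by
    have hc : Continuous fun t : ℝ => t ^ (d + 1 - (i : ℕ)) * k t := by fun_prop
    refine le_of_tendsto_of_tendsto (b := 𝓝[>] (0 : ℝ))
      (((hgc i).tendsto 0).mono_left nhdsWithin_le_nhds)
      ((hc.tendsto 0).mono_left nhdsWithin_le_nhds) ?_
    filter_upwards [self_mem_nhdsWithin] with t ht using hle t ht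
  -- The order d + 1 exceeds every i ≤ d, so the bound vanishes at t = 0.
  have hne : d + 1 - (i : ℕ) ≠ 0 := by omega
  rw [zero_pow hne, zero_mul] at hlim
  have hz : star (v 0) ⬝ᵥ (B i *ᵥ v 0) = 0 := by
    have h0 := (hB i).dotProduct_mulVec_nonneg (v 0)
    refine Complex.ext (le_antisymm hlim (hg0 i 0)) ?_
    exact (Complex.le_def.mp h0).2.symm
  have := ((hB i).dotProduct_mulVec_zero_iff (v 0)).mp hz
  simpa [hv] using this

/-! ### Lifting approximate kernel vectors -/

/-- Every vector that `M` maps into multiples of `λ^k` is congruent modulo `λ` to a vector in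
the kernel of `M`. -/
def LiftsKernel {K : Type*} [CommRing K] (k : ℕ) {m n : Type*} [Fintype n]
    (M : Matrix m n K[X]) : Prop :=
  ∀ (y : n → K[X]) (z : m → K[X]), M *ᵥ y = (X : K[X]) ^ k • z →
    ∃ y₀ y₁ : n → K[X], M *ᵥ y₀ = 0 ∧ y = y₀ + (X : K[X]) • y₁

namespace LiftsKernel

variable {K : Type*} [CommRing K] {k : ℕ}

/-- Polynomial matrices preserve multiples of λ^k and congruence modulo λ, so kernel lifts are
transported by V and its inverse. -/
lemma mul_mul {m n : Type*} [Fintype m] [DecidableEq m] [Fintype n] [DecidableEq n]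
    {M : Matrix m n K[X]} (hM : LiftsKernel k M) {U : Matrix m m K[X]} {V : Matrix n n K[X]}
    (hU : IsUnit U) (hV : IsUnit V) : LiftsKernel k (U * M * V) := by
  intro y z h
  obtain ⟨U, rfl⟩ := hU
  obtain ⟨V, rfl⟩ := hV
  have h1 : M *ᵥ ((V : Matrix n n K[X]) *ᵥ y) =
      (X : K[X]) ^ k • (((U⁻¹ : (Matrix m m K[X])ˣ) : Matrix m m K[X]) *ᵥ z) := by
    rw [← mulVec_smul, ← h, mulVec_mulVec, mulVec_mulVec]
    congr 1
    rw [Matrix.mul_assoc (U : Matrix m m K[X]), ← Matrix.mul_assoc, Units.inv_mul, Matrix.one_mul]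
  obtain ⟨y₀, y₁, h0, h2⟩ := hM _ _ h1
  refine ⟨((V⁻¹ : (Matrix n n K[X])ˣ) : Matrix n n K[X]) *ᵥ y₀,
    ((V⁻¹ : (Matrix n n K[X])ˣ) : Matrix n n K[X]) *ᵥ y₁, ?_, ?_⟩
  · rw [mulVec_mulVec, Matrix.mul_assoc, Units.mul_inv, Matrix.mul_one, ← mulVec_mulVec, h0,
      mulVec_zero]
  · rw [← mulVec_smul, ← mulVec_add, ← h2, mulVec_mulVec, Units.inv_mul, one_mulVec]

lemma of_mul_mul {m n : Type*} [Fintype m] [DecidableEq m] [Fintype n] [DecidableEq n]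
    {M : Matrix m n K[X]} {U : Matrix m m K[X]} {V : Matrix n n K[X]}
    (hM : LiftsKernel k (U * M * V)) (hU : IsUnit U) (hV : IsUnit V) : LiftsKernel k M := by
  obtain ⟨U, rfl⟩ := hU
  obtain ⟨V, rfl⟩ := hV
  convert hM.mul_mul (U⁻¹).isUnit (V⁻¹).isUnit using 1
  rw [Matrix.mul_assoc (U : Matrix m m K[X]), ← Matrix.mul_assoc, Units.inv_mul, Matrix.one_mul,
    Matrix.mul_assoc, Units.mul_inv, Matrix.mul_one]

lemma reindex {m n m' n' : Type*} [Fintype n] [Fintype n'] {M : Matrix m n K[X]}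
    (hM : LiftsKernel k M) (er : m ≃ m') (ec : n ≃ n') :
    LiftsKernel k (Matrix.reindex er ec M) := by
  intro y z h
  have h1 : M *ᵥ (y ∘ ec) = (X : K[X]) ^ k • (z ∘ er) := by
    ext1 i
    have := congrFun h (er i)
    simpa [submatrix_mulVec_equiv] using this
  obtain ⟨y₀, y₁, h0, h2⟩ := hM _ _ h1
  refine ⟨y₀ ∘ ec.symm, y₁ ∘ ec.symm, ?_, ?_⟩
  · rw [reindex_apply, submatrix_mulVec_equiv]
    simp [Function.comp_assoc, h0]
  · ext1 j
    simpa using congrFun h2 (ec.symm j)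

lemma fromBlocks_one {m n o : Type*} [Fintype n] [Fintype o] [DecidableEq o]
    {M : Matrix m n K[X]} (hM : LiftsKernel k M) (hk : k ≠ 0) :
    LiftsKernel k (fromBlocks M 0 0 (1 : Matrix o o K[X])) := by
  intro y z h
  rw [fromBlocks_mulVec] at h
  have h1 : M *ᵥ (y ∘ Sum.inl) = (X : K[X]) ^ k • (z ∘ Sum.inl) := by
    ext1 i
    simpa using congrFun h (Sum.inl i)
  obtain ⟨y₀, y₁, h0, h2⟩ := hM _ _ h1
  -- On the identity block y itself equals λ^k z, already divisible by λ since k ≠ 0, so 0 lifts it.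
  refine ⟨Sum.elim y₀ 0, Sum.elim y₁ ((X : K[X]) ^ (k - 1) • (z ∘ Sum.inr)), ?_, ?_⟩
  · rw [fromBlocks_mulVec]
    simp [h0]
  · ext1 (j | j)
    · simpa using congrFun h2 j
    · have := congrFun h (Sum.inr j)
      obtain ⟨k, rfl⟩ := Nat.exists_eq_succ_of_ne_zero hk
      simpa [pow_succ', mul_assoc] using this

lemma of_blockDiagonal' {o : Type*} [Fintype o] [DecidableEq o] {m n : o → Type*}
    [∀ i, Fintype (n i)] {M : ∀ i, Matrix (m i) (n i) K[X]}
    (hM : LiftsKernel k (blockDiagonal' M)) (i : o) : LiftsKernel k (M i) := by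
  have key : ∀ (y : (Σ i, n i) → K[X]) (j : o) (a : m j),
      (blockDiagonal' M *ᵥ y) ⟨j, a⟩ = (M j *ᵥ fun b => y ⟨j, b⟩) a := by
    intro y j a
    simp only [mulVec, dotProduct, Fintype.sum_sigma]
    rw [Finset.sum_eq_single j]
    · simp
    · intro l _ hl
      refine Finset.sum_eq_zero fun b _ => ?_
      rw [blockDiagonal'_apply_ne _ _ _ hl.symm, zero_mul]
    · simp
  intro y z h
  -- Extend by zero outside block i.
  let y' : (Σ i, n i) → K[X] := fun p => if hp : p.1 = i then y (hp ▸ p.2) else 0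
  let z' : (Σ i, m i) → K[X] := fun p => if hp : p.1 = i then z (hp ▸ p.2) else 0
  have h1 : blockDiagonal' M *ᵥ y' = (X : K[X]) ^ k • z' := by
    ext1 ⟨j, a⟩
    rw [key]
    by_cases hj : j = i
    · subst hj
      simpa [y', z'] using congrFun h a
    · simp [y', z', hj, mulVec, dotProduct]
  obtain ⟨y₀, y₁, h0, h2⟩ := hM _ _ h1
  refine ⟨fun b => y₀ ⟨i, b⟩, fun b => y₁ ⟨i, b⟩, ?_, ?_⟩
  · ext1 a
    rw [← key, h0]
    simp
  · ext1 b
    simpa [y'] using congrFun h2 ⟨i, b⟩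

end LiftsKernel

lemma liftsKernel_matPoly {d n : ℕ} {B : Fin (d + 1) → Matrix (Fin n) (Fin n) ℂ}
    (hB : ∀ i, (B i).PosSemidef) : LiftsKernel (d + 1) (matPoly B) := by
  intro y z h
  have h0 := mulVec_eval_zero_eq_zero hB h
  -- The lift is the constant vector y(0), killed by every coefficient.
  refine ⟨fun j => C ((y j).eval 0), fun j => (y j).divX, ?_, ?_⟩
  · simp only [matPoly, sum_mulVec, smul_mulVec]
    refine Finset.sum_eq_zero fun i _ => ?_
    have : (B i).map C *ᵥ (fun j => (C ((y j).eval 0) : ℂ[X])) = 0 := by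
      ext1 a
      have := congrArg (C : ℂ →+* ℂ[X]) (congrFun (h0 i) a)
      simpa [mulVec, dotProduct, map_sum] using this
    rw [this, smul_zero]
  · ext1 j
    simp only [Pi.add_apply, Pi.smul_apply, smul_eq_mul]
    rw [← coeff_zero_eq_eval_zero, add_comm]
    exact (X_mul_divX_add (y j)).symm

/-! ### The nilpotent Jordan block -/

/-- The nilpotent upper triangular Jordan block. -/
def shiftMatrix (R : Type*) [Zero R] [One R] (k : ℕ) : Matrix (Fin k) (Fin k) R :=
  Matrix.of fun i j => if (j : ℕ) = i + 1 then 1 else 0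

lemma shiftMatrix_map {R S : Type*} [Semiring R] [Semiring S] (f : R →+* S) (k : ℕ) :
    (shiftMatrix R k).map f = shiftMatrix S k := by
  ext i j
  simp [shiftMatrix, apply_ite f]

lemma jordanBlock_zero (k : ℕ) : jordanBlock k 0 = shiftMatrix ℂ k := by
  ext i j
  by_cases h : i = j
  · subst h; simp [jordanBlock, shiftMatrix]
  · simp [jordanBlock, shiftMatrix, h]

lemma det_X_sub_shiftMatrix (K : Type*) [CommRing K] (k : ℕ) :
    ((X : K[X]) • (1 : Matrix (Fin k) (Fin k) K[X]) - shiftMatrix K[X] k).det = X ^ k := by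
  rw [det_of_isUpperTriangular]
  · simp [shiftMatrix]
  · intro i j hij
    have h1 : (j : ℕ) < i := hij
    simp [shiftMatrix, show i ≠ j by rintro rfl; omega,
      show (j : ℕ) ≠ i + 1 by omega]

/-- The rows cancel consecutive powers; only the last row, with no successor, leaves X^k. -/
lemma X_sub_shiftMatrix_mulVec_pow (K : Type*) [CommRing K] (k : ℕ) :
    ((X : K[X]) • (1 : Matrix (Fin k) (Fin k) K[X]) - shiftMatrix K[X] k) *ᵥ
      (fun i => X ^ (i : ℕ)) = (X : K[X]) ^ k • fun i : Fin k => if (i : ℕ) + 1 = k then (1 : K[X]) else 0 := by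
  ext1 i
  have h1 : (shiftMatrix K[X] k *ᵥ fun i => X ^ (i : ℕ)) i =
      if (i : ℕ) + 1 = k then 0 else (X : K[X]) ^ ((i : ℕ) + 1) := by
    simp only [mulVec, dotProduct, shiftMatrix, of_apply, ite_mul, one_mul, zero_mul]
    split_ifs with h
    · refine Finset.sum_eq_zero fun j _ => if_neg ?_
      omega
    · rw [Finset.sum_eq_single ⟨i + 1, by omega⟩]
      · simp
      · intro j _ hj
        refine if_neg fun hj' => hj (Fin.ext hj')
      · simp
  rw [sub_mulVec, Pi.sub_apply, h1, smul_mulVec, one_mulVec]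
  simp only [Pi.smul_apply, smul_eq_mul]
  split_ifs with h
  · rw [sub_zero, mul_one, ← pow_succ', h]
  · rw [mul_zero, ← pow_succ', sub_self]

/-- The determinant X^σ is nonzero, so the only kernel vector is 0. A lift would make (1, X, ...,
X^(σ-1)) divisible by X, which its first entry forbids; an empty block has no such entry. -/
lemma le_of_liftsKernel_X_sub_shiftMatrix {K : Type*} [Field K] {k σ : ℕ}
    (h : LiftsKernel k ((X : K[X]) • (1 : Matrix (Fin σ) (Fin σ) K[X]) - shiftMatrix K[X] σ)) :
    σ < k ∨ σ = 0 := by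
  by_contra! hσ
  obtain ⟨hk, h0⟩ := hσ
  have h1 := X_sub_shiftMatrix_mulVec_pow K σ
  rw [← Nat.add_sub_of_le hk, pow_add, mul_smul, Nat.add_sub_of_le hk] at h1
  obtain ⟨y₀, y₁, h2, h3⟩ := h _ _ h1
  have h4 : y₀ = 0 := by
    refine Matrix.eq_zero_of_mulVec_eq_zero ?_ h2
    rw [det_X_sub_shiftMatrix]
    exact pow_ne_zero _ X_ne_zero
  have h5 := congrArg (eval 0) (congrFun h3 ⟨0, by omega⟩)
  simp [h4] at h5

/-! ### Pencils and block diagonal matrices -/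

namespace Pencil

lemma mul_toPolyMatrix_mul {K : Type*} [CommRing K] {m n : Type} [Fintype m] [Fintype n]
    (L : Pencil m n K) (S : Matrix m m K) (T : Matrix n n K) :
    S.map C * L.toPolyMatrix * T.map C = (Pencil.mk (S * L.E * T) (S * L.A * T)).toPolyMatrix := by
  simp only [toPolyMatrix, Matrix.mul_sub, Matrix.sub_mul, Matrix.mul_smul, Matrix.smul_mul,
    Matrix.map_mul]

lemma toPolyMatrix_reindex_blockDiagonal' {K : Type*} [CommRing K] {o m n : Type} [DecidableEq o]
    {m' n' : o → Type} (p : ∀ i, Pencil (m' i) (n' i) K) (er : (Σ i, m' i) ≃ m)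
    (ec : (Σ i, n' i) ≃ n) :
    (Pencil.mk (Matrix.reindex er ec (blockDiagonal' fun i => (p i).E))
      (Matrix.reindex er ec (blockDiagonal' fun i => (p i).A))).toPolyMatrix =
      Matrix.reindex er ec (blockDiagonal' fun i => (p i).toPolyMatrix) := by
  ext1 i j
  simp only [toPolyMatrix, reindex_apply, submatrix_apply, Matrix.sub_apply, Matrix.smul_apply,
    Matrix.map_apply, blockDiagonal'_apply]
  split_ifs <;> simp

lemma toPolyMatrix_reindex_blockDiagonal {K : Type*} [CommRing K] {o m n m' n' : Type}
    [DecidableEq o] (p : o → Pencil m' n' K) (er : m' × o ≃ m) (ec : n' × o ≃ n) :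
    (Pencil.mk (Matrix.reindex er ec (blockDiagonal fun i => (p i).E))
      (Matrix.reindex er ec (blockDiagonal fun i => (p i).A))).toPolyMatrix =
      Matrix.reindex er ec (blockDiagonal fun i => (p i).toPolyMatrix) := by
  ext1 i j
  simp only [toPolyMatrix, reindex_apply, submatrix_apply, Matrix.sub_apply, Matrix.smul_apply,
    Matrix.map_apply, blockDiagonal_apply]
  split_ifs <;> simp

end Pencil

/-! ### The index bound for a strong linearization -/

lemma toPolyMatrix_rev_pencil_N (σ : ℕ) :
    (KroneckerBlock.N σ).pencil.rev.toPolyMatrix =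
      (X : ℂ[X]) • (1 : Matrix (Fin σ) (Fin σ) ℂ[X]) - shiftMatrix ℂ[X] σ := by
  simp [Pencil.toPolyMatrix, Pencil.rev, KroneckerBlock.pencil, jordanBlock_zero, shiftMatrix_map]

/-- The index of a strong linearization of a matrix polynomial of grade `d` with positive
semidefinite coefficients is at most `d`. -/
lemma IsStrongLinearization.index_le {𝕜 : Type*} [RCLike 𝕜] {d n : ℕ}
    {A : Fin (d + 1) → Matrix (Fin n) (Fin n) 𝕜} (hA : ∀ i, (A i).PosSemidef)
    {L : Pencil (Fin (d * n)) (Fin (d * n)) 𝕜} (hL : IsStrongLinearization A L) :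
    L.index ≤ d := by
  refine iSup₂_le fun σ ⟨r, b, ⟨er, ec, S, T, hS, hT, hE, hA'⟩, i, hi⟩ => ?_
  obtain ⟨e, U, V, hU, hV, h⟩ := hL.2
  set f := RCLike.toComplexHom 𝕜 with hf
  have hM : L.rev.toPolyMatrix.map (mapRingHom f) = L.complexify.rev.toPolyMatrix :=
    Pencil.toPolyMatrix_map f L.rev
  have h1 : U.map (mapRingHom f) * L.complexify.rev.toPolyMatrix * V.map (mapRingHom f) =
      Matrix.reindex e e (fromBlocks (matPoly fun i => (A i.rev).map f) 0 0 1) := by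
    rw [← hM, ← Matrix.map_mul, ← Matrix.map_mul, h, ← matPoly_map]
    simp only [reindex_apply, ← submatrix_map, fromBlocks_map]
    simp
  have h2 : LiftsKernel (d + 1) L.complexify.rev.toPolyMatrix := by
    refine LiftsKernel.of_mul_mul (U := U.map (mapRingHom f)) (V := V.map (mapRingHom f)) ?_
      (hU.map (mapRingHom f).mapMatrix) (hV.map (mapRingHom f).mapMatrix)
    rw [h1]
    exact ((liftsKernel_matPoly fun i => (hA i.rev).map_toComplexHom).fromBlocks_one
      d.succ_ne_zero).reindex e e
  -- The same S and T bring the reversed pencil to the reversed Kronecker blocks.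
  have h3 : S.map C * L.complexify.rev.toPolyMatrix * T.map C =
      Matrix.reindex er ec (blockDiagonal' fun i => (b i).pencil.rev.toPolyMatrix) := by
    rw [Pencil.mul_toPolyMatrix_mul, ← Pencil.toPolyMatrix_reindex_blockDiagonal']
    exact congrArg Pencil.toPolyMatrix (congrArg₂ Pencil.mk hA' hE)
  have h4 := h2.mul_mul (hS.map (C : ℂ →+* ℂ[X]).mapMatrix) (hT.map (C : ℂ →+* ℂ[X]).mapMatrix)
  rw [RingHom.mapMatrix_apply, RingHom.mapMatrix_apply, h3] at h4
  have h5 := h4.reindex er.symm ec.symm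
  simp only [← reindex_symm, Equiv.symm_apply_apply] at h5
  have h6 := h5.of_blockDiagonal' i
  rw [hi, toPolyMatrix_rev_pencil_N] at h6
  rcases le_of_liftsKernel_X_sub_shiftMatrix h6 with h7 | h7
  · exact_mod_cast Nat.lt_succ_iff.mp h7
  · simp [h7]

/-! ### A pencil whose index is attained -/

/-- The matrix is triangular with diagonal entries -1. -/
lemma isUnit_X_shiftMatrix_sub_one (K : Type*) [CommRing K] (k : ℕ) :
    IsUnit ((X : K[X]) • shiftMatrix K[X] k - 1) := by
  rw [isUnit_iff_isUnit_det, det_of_isUpperTriangular]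
  · simpa [shiftMatrix] using isUnit_one.neg.pow k
  · intro i j hij
    have h1 : (j : ℕ) < i := hij
    simp [shiftMatrix, show i ≠ j by rintro rfl; omega, show (j : ℕ) ≠ i + 1 by omega]

/-- The Smith form of `λ I - J_{k+1}(0)`. -/
lemma exists_smith_X_sub_shiftMatrix (K : Type*) [Field K] (k : ℕ) :
    ∃ U V : Matrix (Fin (k + 1)) (Fin (k + 1)) K[X], IsUnit U ∧ IsUnit V ∧
      U * ((X : K[X]) • 1 - shiftMatrix K[X] (k + 1)) * V =
        diagonal (Fin.cons (X ^ (k + 1)) 1) := by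
  set M : Matrix (Fin (k + 1)) (Fin (k + 1)) K[X] := (X : K[X]) • 1 - shiftMatrix K[X] (k + 1)
    with hM
  set δ : Fin (k + 1) → K[X] := Fin.cons (X ^ (k + 1)) 1 with hδ
  -- With the vector of powers as first column, V makes the first column of M V equal to X^(k+1)
  -- times the last unit vector; W is M V with that factor removed.
  set V : Matrix (Fin (k + 1)) (Fin (k + 1)) K[X] := updateCol 1 0 fun i => X ^ (i : ℕ) with hV
  set W : Matrix (Fin (k + 1)) (Fin (k + 1)) K[X] :=
    updateCol M 0 fun i => if (i : ℕ) + 1 = k + 1 then 1 else 0 with hW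
  have hdetV : V.det = 1 := by
    rw [det_of_isLowerTriangular]
    · refine Finset.prod_eq_one fun i _ => ?_
      cases i using Fin.cases <;> simp [hV]
    · intro i j hij
      have h1 : i < j := hij
      rw [hV, updateCol_apply, if_neg (Fin.pos_iff_ne_zero.mp (i.zero_le.trans_lt h1)),
        one_apply_ne h1.ne]
  have hMV : M * V = W * diagonal δ := by
    ext1 i j
    rw [mul_diagonal]
    cases j using Fin.cases with
    | zero =>
      have h1 := congrFun (X_sub_shiftMatrix_mulVec_pow K (k + 1)) i
      simp only [hW, hδ, updateCol_self, Fin.cons_zero]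
      rw [mul_comm]
      refine Eq.trans ?_ h1
      simp [Matrix.mul_apply, mulVec, dotProduct, hV, hM]
    | succ j =>
      simp [hW, hδ, hV, Matrix.mul_apply, Matrix.one_apply]
  -- Cancel X^(k+1) = det M = det (diagonal δ) in the determinants of M V = W diag(δ).
  have hdetW : W.det = 1 := by
    have h1 := congrArg det hMV
    have h2 : (diagonal δ).det = X ^ (k + 1) := by
      rw [det_diagonal, Fin.prod_univ_succ]
      simp [hδ]
    rw [det_mul, det_mul, hdetV, h2, hM, det_X_sub_shiftMatrix, mul_one] at h1
    exact mul_right_cancel₀ (pow_ne_zero _ X_ne_zero) (h1.symm.trans (one_mul _).symm)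
  have hWu : IsUnit W.det := hdetW ▸ isUnit_one
  refine ⟨W⁻¹, V, ?_, ?_, ?_⟩
  · exact (isUnit_nonsing_inv_iff).mpr ((isUnit_iff_isUnit_det W).mpr hWu)
  · exact (isUnit_iff_isUnit_det V).mpr (hdetV ▸ isUnit_one)
  · rw [Matrix.mul_assoc, hMV, ← Matrix.mul_assoc, nonsing_inv_mul _ hWu, Matrix.one_mul]

/-- The pencil with `n` Jordan blocks of size `d` at infinity. -/
def nilpotentPencil (K : Type*) [CommRing K] (d n : ℕ) : Pencil (Fin (d * n)) (Fin (d * n)) K :=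
  ⟨Matrix.reindex finProdFinEquiv finProdFinEquiv (blockDiagonal fun _ : Fin n => shiftMatrix K d),
    Matrix.reindex finProdFinEquiv finProdFinEquiv (blockDiagonal fun _ : Fin n => 1)⟩

lemma toPolyMatrix_nilpotentPencil (K : Type*) [CommRing K] (d n : ℕ) :
    (nilpotentPencil K d n).toPolyMatrix = Matrix.reindex finProdFinEquiv finProdFinEquiv
      (blockDiagonal fun _ : Fin n => (X : K[X]) • shiftMatrix K[X] d - 1) := by
  refine (Pencil.toPolyMatrix_reindex_blockDiagonal
    (fun _ : Fin n => Pencil.mk (shiftMatrix K d) 1) finProdFinEquiv finProdFinEquiv).trans ?_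
  simp [Pencil.toPolyMatrix, shiftMatrix_map]

lemma toPolyMatrix_rev_nilpotentPencil (K : Type*) [CommRing K] (d n : ℕ) :
    (nilpotentPencil K d n).rev.toPolyMatrix = Matrix.reindex finProdFinEquiv finProdFinEquiv
      (blockDiagonal fun _ : Fin n => (X : K[X]) • 1 - shiftMatrix K[X] d) := by
  refine (Pencil.toPolyMatrix_reindex_blockDiagonal
    (fun _ : Fin n => Pencil.mk 1 (shiftMatrix K d)) finProdFinEquiv finProdFinEquiv).trans ?_
  simp [Pencil.toPolyMatrix, shiftMatrix_map]

lemma isUnit_reindex_blockDiagonal {R : Type*} [CommRing R] {m o l : Type*} [Fintype m]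
    [DecidableEq m] [Fintype o] [DecidableEq o] [Fintype l] [DecidableEq l] (e : m × o ≃ l)
    {M : Matrix m m R} (hM : IsUnit M) :
    IsUnit (Matrix.reindex e e (blockDiagonal fun _ : o => M)) := by
  rw [isUnit_iff_isUnit_det] at hM ⊢
  rw [det_reindex_self, det_blockDiagonal, Finset.prod_const]
  exact hM.pow _

/-- The first block of rows followed by the remaining ones. -/
def sumProdSuccEquiv (k : ℕ) (α : Type*) : α ⊕ Fin k × α ≃ Fin (k + 1) × α where
  toFun := Sum.elim (fun a => (0, a)) fun p => (p.1.succ, p.2)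
  invFun p := Fin.cases (motive := fun _ => α ⊕ Fin k × α) (Sum.inl p.2)
    (fun i => Sum.inr (i, p.2)) p.1
  left_inv := by rintro (a | ⟨i, a⟩) <;> rfl
  right_inv := by
    rintro ⟨i, a⟩
    cases i using Fin.cases <;> rfl

/-- The constant polynomial `I`, with grade `d`. -/
def constOneCoeff (K : Type*) [CommRing K] (d n : ℕ) :
    Fin (d + 1) → Matrix (Fin n) (Fin n) K :=
  Pi.single 0 1

lemma matPoly_constOneCoeff (K : Type*) [CommRing K] (d n : ℕ) :
    matPoly (constOneCoeff K d n) = 1 := by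
  rw [matPoly, Finset.sum_eq_single 0]
  · simp [constOneCoeff]
  · intro i _ hi
    simp [constOneCoeff, hi]
  · simp

lemma matPoly_constOneCoeff_rev (K : Type*) [CommRing K] (d n : ℕ) :
    matPoly (fun i => constOneCoeff K d n i.rev) = (X : K[X]) ^ d • 1 := by
  rw [matPoly, Finset.sum_eq_single (Fin.last d)]
  · simp [constOneCoeff]
  · intro i _ hi
    have : i.rev ≠ 0 := fun h => hi (by rw [← Fin.rev_rev i, h, Fin.rev_zero])
    simp [constOneCoeff, this]
  · simp

/-- The pencil itself is unimodular, hence equivalent to I. For its reversal, the Smith form is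
applied in each of the n blocks. -/
lemma isStrongLinearization_nilpotentPencil (K : Type*) [Field K] (k n : ℕ) :
    IsStrongLinearization (constOneCoeff K (k + 1) n) (nilpotentPencil K (k + 1) n) := by
  let F : Fin (k + 1) × Fin n ≃ Fin ((k + 1) * n) := finProdFinEquiv
  -- The first summand collects the first row of each of the n blocks, where the Smith form puts
  -- X^(k+1).
  let e : Fin n ⊕ Fin ((k + 1 - 1) * n) ≃ Fin ((k + 1) * n) :=
    ((Equiv.sumCongr (Equiv.refl _) finProdFinEquiv.symm).trans (sumProdSuccEquiv k
      (Fin n))).trans F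
  constructor
  · have hu := isUnit_reindex_blockDiagonal (o := Fin n) F (isUnit_X_shiftMatrix_sub_one K (k + 1))
    obtain ⟨u, hu⟩ := hu
    refine ⟨e, (u⁻¹ : (Matrix _ _ K[X])ˣ), 1, (u⁻¹).isUnit, isUnit_one, ?_⟩
    rw [toPolyMatrix_nilpotentPencil, ← hu, Units.inv_mul, matPoly_constOneCoeff, fromBlocks_one]
    simp
  · obtain ⟨U, V, hU, hV, h⟩ := exists_smith_X_sub_shiftMatrix K k
    refine ⟨e, _, _, isUnit_reindex_blockDiagonal (o := Fin n) F hU,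
      isUnit_reindex_blockDiagonal (o := Fin n) F hV, ?_⟩
    rw [toPolyMatrix_rev_nilpotentPencil, matPoly_constOneCoeff_rev]
    simp only [reindex_apply]
    rw [submatrix_mul_equiv, submatrix_mul_equiv, ← blockDiagonal_mul, ← blockDiagonal_mul, h,
      blockDiagonal_diagonal, smul_one_eq_diagonal, ← diagonal_one, fromBlocks_diagonal,
      submatrix_diagonal_equiv, submatrix_diagonal_equiv]
    congr 1
    ext1 p
    obtain ⟨s, rfl⟩ := e.surjective p
    rw [Function.comp_apply, Function.comp_apply, Equiv.symm_apply_apply]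
    rcases s with a | a <;> simp [e, F, sumProdSuccEquiv]

lemma le_index_nilpotentPencil {𝕜 : Type*} [RCLike 𝕜] (d : ℕ) {n : ℕ} (hn : 1 ≤ n) :
    (d : ℕ∞) ≤ (nilpotentPencil 𝕜 d n).index := by
  refine le_iSup₂_of_le d ⟨n, fun _ => KroneckerBlock.N d, ?_, ⟨0, hn⟩, rfl⟩ le_rfl
  -- Block index and position within the block are swapped to match `finProdFinEquiv`.
  let e : (Σ _ : Fin n, Fin d) ≃ Fin (d * n) :=
    ((Equiv.sigmaEquivProd _ _).trans (Equiv.prodComm _ _)).trans finProdFinEquiv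
  have key (M : Matrix (Fin d) (Fin d) 𝕜) :
      (Matrix.reindex finProdFinEquiv finProdFinEquiv (blockDiagonal fun _ : Fin n => M)).map
        (RCLike.map 𝕜 ℂ) =
      Matrix.reindex e e (blockDiagonal' fun _ : Fin n => M.map (RCLike.map 𝕜 ℂ)) := by
    ext1 i j
    obtain ⟨⟨i, a⟩, rfl⟩ := e.surjective i
    obtain ⟨⟨j, b⟩, rfl⟩ := e.surjective j
    simp only [reindex_apply, Matrix.map_apply, submatrix_apply, Equiv.symm_apply_apply]
    by_cases h : i = j
    · subst h; simp [e, blockDiagonal_apply]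
    · simp [e, blockDiagonal_apply, blockDiagonal'_apply_ne _ _ _ h, h]
  refine ⟨e, e, 1, 1, isUnit_one, isUnit_one, ?_, ?_⟩
  · rw [Matrix.one_mul, Matrix.mul_one]
    refine (key _).trans ?_
    simp only [KroneckerBlock.pencil, jordanBlock_zero]
    rw [show (shiftMatrix 𝕜 d).map (RCLike.map 𝕜 ℂ) = shiftMatrix ℂ d from
      shiftMatrix_map (RCLike.toComplexHom 𝕜) d]
  · rw [Matrix.one_mul, Matrix.mul_one]
    refine (key _).trans ?_
    simp only [KroneckerBlock.pencil]
    rw [show (1 : Matrix (Fin d) (Fin d) 𝕜).map (RCLike.map 𝕜 ℂ) = 1 from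
      Matrix.map_one (RCLike.toComplexHom 𝕜) (map_zero _) (map_one _)]

/-! ### The bound and its attainment -/

lemma matPolyIndex_le {𝕜 : Type*} [RCLike 𝕜] {d n : ℕ}
    {A : Fin (d + 1) → Matrix (Fin n) (Fin n) 𝕜} (hA : ∀ i, (A i).PosSemidef) :
    matPolyIndex A ≤ d :=
  iSup₂_le fun _ hL => hL.index_le hA

theorem theorem5p4 {𝕜 : Type*} [RCLike 𝕜] (d : ℕ) (hd : 1 ≤ d) :
    (∀ (n : ℕ) (A : Fin (d + 1) → Matrix (Fin n) (Fin n) 𝕜),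
      (∀ i, (A i).PosSemidef) → (Even d → IsUnit (A 0)) → matPolyIndex A ≤ d) ∧
    (∀ n : ℕ, 1 ≤ n → ∃ A : Fin (d + 1) → Matrix (Fin n) (Fin n) 𝕜,
      (∀ i, (A i).PosSemidef) ∧ (Even d → IsUnit (A 0)) ∧ matPolyIndex A = d) := by
  refine ⟨fun n A hA _ => matPolyIndex_le hA, fun n hn => ?_⟩
  have hpos : ∀ i, (constOneCoeff 𝕜 d n i).PosSemidef := by
    intro i
    by_cases h : i = 0
    · subst h
      simpa [constOneCoeff] using PosSemidef.one
    · simpa [constOneCoeff, h] using PosSemidef.zero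
  refine ⟨constOneCoeff 𝕜 d n, hpos, fun _ => ?_, le_antisymm (matPolyIndex_le hpos) ?_⟩
  · simp [constOneCoeff]
  · obtain ⟨k, rfl⟩ := Nat.exists_eq_succ_of_ne_zero (by omega : d ≠ 0)
    -- One strong linearization bounds the supremum from below.
    exact le_iSup₂_of_le _ (isStrongLinearization_nilpotentPencil 𝕜 k n)
      (le_index_nilpotentPencil _ hn)
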